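/- Let $n\in\mathbb N$, write points of $\mathbb R^{2n}$ as $x=(q,p)$ with $q,p\in\mathbb R^n$, and let $$J=\begin{pmatrix}0&I_n\\-I_n&0\end{pmatrix},\qquad I_1=\begin{pmatrix}I_n&0\\0&0\end{pmatrix},\qquad I_2=\begin{pmatrix}0&0\\0&I_n\end{pmatrix}.$$ Let $\Omega\subset\mathbb R^{2n}$ be open, $\mathcal H\in C^2(\Omega)$, $\Delta T>0$, and let $U\subset\Omega$ be open and such that for every $x\in U$ the solution $t\mapsto\Phi^t(x)$ of $\dot x=J\nabla\mathcal H(x)$ with initial value $x$ exists in $\Omega$ on $[0,\Delta T]$. Write the flow map as $\Phi^{\Delta T}(q,p)=(\mathbf Q(q,p),\mathbf P(q,p))$ and put $\mathbf D=\partial\mathbf P/\partial p$. Suppose that (i) $\mathbf D(q,p)$ is invertible for all $(q,p)\in U$; (ii) the map $\Psi:U\to W$, $\Psi(q,p)=(q,\mathbf P(q,p))$, is a ($C^1$) diffeomorphism onto a simply connected open set $W\subset\mathbb R^{2n}$. Then there are functions $\mathbf p,\mathbf Q\in C^1(W,\mathbb R^n)$, which are uniquely determined on $W$ by the condition that for all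 $(q,P)\in W$ $$(q,\mathbf p(q,P))\in U,\qquad \Psi(q,\mathbf p(q,P))=(q,P),\qquad \Phi^{\Delta T}(q,\mathbf p(q,P))=(\mathbf Q(q,P),P),$$ and there is a function $S\in C^1(W)$, unique in $C^1(W)$ up to an additive constant, such that on $W$ $$\mathbf p(q,P)=\partial_qS(q,P),\qquad \mathbf Q(q,P)=\partial_PS(q,P).$$ Moreover, for every such $S$, the function $S^{\Delta T}(q,P):=\frac1{\Delta T}\bigl(S(q,P)-q^\top P\bigr)$ satisfies, for all $x\in U$, $$J^\top\,\frac{\Phi^{\Delta T}(x)-x}{\Delta T}=\nabla_{(q,P)}S^{\Delta T}\bigl(I_1x+I_2\Phi^{\Delta T}(x)\bigr).$$ -/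

import Mathlib

open Set

noncomputable section

/-- The configuration space `ℝⁿ` with the Euclidean structure. -/
abbrev Config (n : ℕ) : Type := EuclideanSpace ℝ (Fin n)

/-- The phase space `ℝ²ⁿ = ℝⁿ × ℝⁿ` with the Euclidean structure. For a point `x = (q, p)`, the
position is `x.fst` and the momentum is `x.snd`. -/
abbrev PhaseSpace (n : ℕ) : Type := WithLp 2 (Config n × Config n)

/-- The point `(q, p)` of phase space. -/
def pt {n : ℕ} (q p : Config n) : PhaseSpace n := WithLp.toLp 2 (q, p)

/-- The canonical matrix `J = [[0, I], [-I, 0]]`, acting on phase space. -/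
def canonJ {n : ℕ} (x : PhaseSpace n) : PhaseSpace n := pt x.snd (-x.fst)

/-- The transpose `Jᵀ = [[0, -I], [I, 0]]`, acting on phase space. -/
def canonJT {n : ℕ} (x : PhaseSpace n) : PhaseSpace n := pt (-x.snd) x.fst

/-- `canonJT` is indeed the transpose of `canonJ`. -/
theorem inner_canonJ {n : ℕ} (x y : PhaseSpace n) :
    inner ℝ (canonJ x) y = inner ℝ x (canonJT y) := by
  simp [canonJ, canonJT, pt, WithLp.prod_inner_apply]
  ring

/-- The block projection `I₁ = [[I, 0], [0, 0]]`. -/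
def blockI₁ {n : ℕ} (x : PhaseSpace n) : PhaseSpace n := pt x.fst 0

/-- The block projection `I₂ = [[0, 0], [0, I]]`. -/
def blockI₂ {n : ℕ} (x : PhaseSpace n) : PhaseSpace n := pt 0 x.snd

/-- `Φ` is, for the starting points in `D` and the times in `[0, T]`, the flow of the Hamiltonian
system `ẋ = J ∇H(x)` in `Ω`: for `x ∈ D` the curve `t ↦ Φ t x` starts at `x`, stays in `Ω`
(where `H` is defined) and solves the differential equation on `[0, T]`. -/
structure IsHamiltonianFlow {n : ℕ} (H : PhaseSpace n → ℝ) (Ω D : Set (PhaseSpace n)) (T : ℝ)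
    (Φ : ℝ → PhaseSpace n → PhaseSpace n) : Prop where
  initial : ∀ x ∈ D, Φ 0 x = x
  mem : ∀ x ∈ D, ∀ t ∈ Icc 0 T, Φ t x ∈ Ω
  ode : ∀ x ∈ D, IsIntegralCurveOn (fun t => Φ t x) (fun _ y => canonJ (gradient H y)) (Icc 0 T)

/-- For a map `F = (𝐐, 𝐏)` of phase space, the block `∂𝐏/∂p` of its Jacobian at `x = (q, p)`. -/
def blockD {n : ℕ} (F : PhaseSpace n → PhaseSpace n) (x : PhaseSpace n) : Config n →L[ℝ] Config n :=
  fderiv ℝ (fun p : Config n => (F (pt x.fst p)).snd) x.snd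

/-- For a map `F = (𝐐, 𝐏)` of phase space, the map `Ψ(q, p) = (q, 𝐏(q, p))`. -/
def mixedMap {n : ℕ} (F : PhaseSpace n → PhaseSpace n) (x : PhaseSpace n) : PhaseSpace n :=
  pt x.fst (F x).snd

/-- `f` restricts to a (`C¹`) diffeomorphism from `U` onto `W` (for open `U` and `W`). -/
def IsDiffeoOn {E : Type*} [NormedAddCommGroup E] [NormedSpace ℝ E] (f : E → E) (U W : Set E) :
    Prop :=
  BijOn f U W ∧ ContDiffOn ℝ 1 f U ∧ ∃ g : E → E, InvOn g f U W ∧ ContDiffOn ℝ 1 g W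

/-- `p` and `Q` are the old momentum and the new position as functions of the mixed variables
`w = (q, P) ∈ W`, for the map `F` on `U`: `(q, p(q, P))` is the point of `U` that
`Ψ` sends to `(q, P)`, and `F(q, p(q, P)) = (Q(q, P), P)`. -/
def IsMixedRepresentation {n : ℕ} (F : PhaseSpace n → PhaseSpace n) (U W : Set (PhaseSpace n))
    (p Q : PhaseSpace n → Config n) : Prop :=
  ∀ w ∈ W, pt w.fst (p w) ∈ U ∧ mixedMap F (pt w.fst (p w)) = w ∧
    F (pt w.fst (p w)) = pt (Q w) w.snd

/-- `S ∈ C¹(W)` has the partial gradients `∂_q S = p` and `∂_P S = Q` on `W`. -/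
def IsPotential {n : ℕ} (W : Set (PhaseSpace n)) (p Q : PhaseSpace n → Config n)
    (S : PhaseSpace n → ℝ) : Prop :=
  ContDiffOn ℝ 1 S W ∧ ∀ w ∈ W,
    HasGradientAt (fun q : Config n => S (pt q w.snd)) (p w) w.fst ∧
    HasGradientAt (fun P : Config n => S (pt w.fst P)) (Q w) w.snd

/-- `S^T(q, P) = (S(q, P) - qᵀ P) / T`. -/
def typeII {n : ℕ} (T : ℝ) (S : PhaseSpace n → ℝ) (w : PhaseSpace n) : ℝ :=
  (S w - inner ℝ w.fst w.snd) / T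

end

/-! Since `H` is `C²`, the field `J ∇H` is `C¹`; hence `Φ T` is `C¹` and its derivative solves the
variational equation (`exists_hasStrictFDerivAt_flow`). Symmetry of the Hessian makes the symplectic
form constant along that equation (`contDiffOn_and_symplectic_flow`), that is, `dp ∧ dq = dP ∧ dQ`.
In the coordinates `(q, P)` supplied by the inverse of `Ψ`, this says `d(p dq + Q dP) = dp ∧ dq + dQ
∧ dP = 0` (`symmetric_mixed_of_symplectic`). A closed form on a simply connected open set is exact,
and its primitive is `S`; for a `C¹` form this is the Poincaré lemma, obtained by gluing primitives
on balls through a covering space. Connectedness of `W` gives uniqueness up to a constant, and the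
last identity is the gradient of `S - qᵀ P` read off at `Ψ(x)`. -/

/-! ### Dependence of a flow on its initial value. -/

/-- A curve whose velocity is at most `c` times its norm whenever it meets the exponential
barrier `η * exp (L * t)`, where `c < L`, stays below the barrier. -/
theorem norm_le_mul_exp_of_norm_deriv_le {E : Type*} [NormedAddCommGroup E] [NormedSpace ℝ E]
    {f f' : ℝ → E} {T η c L : ℝ} (hη : 0 < η) (hcL : c < L)
    (hf : ∀ t ∈ Icc 0 T, HasDerivWithinAt f (f' t) (Icc 0 T) t) (h0 : ‖f 0‖ ≤ η)
    (hbound : ∀ t ∈ Icc 0 T, ‖f t‖ = η * Real.exp (L * t) →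
      ‖f' t‖ ≤ c * (η * Real.exp (L * t))) :
    ∀ t ∈ Icc 0 T, ‖f t‖ ≤ η * Real.exp (L * t) := by
  have hB (t : ℝ) : HasDerivAt (fun t => η * Real.exp (L * t)) (L * (η * Real.exp (L * t))) t := by
    have := ((((hasDerivAt_id t).const_mul L).exp).const_mul η)
    exact this.congr_deriv (by simp; ring)
  -- The gap `c < L` makes the barrier strictly steeper than the curve at every contact. A velocity
  -- bound is needed only at contacts, so it may come from an estimate valid only near a reference
  -- trajectory.
  refine image_norm_le_of_norm_deriv_right_lt_deriv_boundary (f' := f')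
    (fun t ht => (hf t ht).continuousWithinAt) (fun t ht => ?_) (by simpa using h0) hB ?_
  · exact (hf t (Ico_subset_Icc_self ht)).mono_of_mem_nhdsWithin (Icc_mem_nhdsGE_of_mem ht)
  · intro t ht heq
    refine (hbound t (Ico_subset_Icc_self ht) heq).trans_lt ?_
    have : 0 < η * Real.exp (L * t) := by positivity
    gcongr

open Metric in
/-- A `C¹` map is uniformly strictly differentiable near a compact set. -/
theorem ContDiffOn.exists_uniform_norm_sub_fderiv_le {E F : Type*} [NormedAddCommGroup E]
    [NormedSpace ℝ E] [NormedAddCommGroup F] [NormedSpace ℝ F] {v : E → F} {Ω K : Set E}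
    (hΩ : IsOpen Ω) (hv : ContDiffOn ℝ 1 v Ω) (hK : IsCompact K) (hKΩ : K ⊆ Ω)
    {ε : ℝ} (hε : 0 < ε) :
    ∃ δ > 0, ∀ z ∈ K, ∀ a ∈ ball z δ, ∀ b ∈ ball z δ,
      ‖v a - v b - fderiv ℝ v z (a - b)‖ ≤ ε * ‖a - b‖ := by
  obtain ⟨δ₁, hδ₁, hsub⟩ := hK.exists_thickening_subset_open hΩ hKΩ
  have hcont : ∀ a ∈ K, ContinuousAt (fderiv ℝ v) a := fun a ha =>
    (hv.continuousOn_fderiv_of_isOpen hΩ le_rfl).continuousAt (hΩ.mem_nhds (hKΩ ha))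
  obtain ⟨δ₂, hδ₂, hδ⟩ := mem_uniformity_dist.1
    (hK.uniformContinuousAt_of_continuousAt _ hcont (dist_mem_uniformity hε))
  refine ⟨min δ₁ δ₂, lt_min hδ₁ hδ₂, fun z hz a ha b hb => ?_⟩
  -- Mean value inequality for `v` minus its linear part at the centre `z`; compactness makes the
  -- radius independent of `z`.
  refine Convex.norm_image_sub_le_of_norm_fderiv_le' (𝕜 := ℝ) (s := ball z (min δ₁ δ₂))
    (fun x hx => ?_) (fun x hx => ?_) (convex_ball _ _) hb ha
  · have : x ∈ Ω := hsub (mem_thickening_iff.2 ⟨z, hz, hx.trans_le (min_le_left _ _)⟩)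
    exact (hv.differentiableOn one_ne_zero).differentiableAt (hΩ.mem_nhds this)
  · have h : Dist.dist z x < δ₂ := by
      rw [dist_comm]; exact (mem_ball.1 hx).trans_le (min_le_right _ _)
    have := hδ h hz
    simp only [mem_ofPred_eq] at this
    rw [← dist_eq_norm, dist_comm]
    exact this.le

/-- Concatenation of integral curves. -/
theorem IsIntegralCurveOn.ite {E : Type*} [NormedAddCommGroup E] [NormedSpace ℝ E]
    {γ₁ γ₂ : ℝ → E} {v : ℝ → E → E} {a b c : ℝ} (hab : a ≤ b) (hbc : b ≤ c)
    (h₁ : IsIntegralCurveOn γ₁ v (Icc a b)) (h₂ : IsIntegralCurveOn γ₂ v (Icc b c))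
    (hb : γ₁ b = γ₂ b) :
    IsIntegralCurveOn (fun t => if t ≤ b then γ₁ t else γ₂ t) v (Icc a c) := by
  have e₁ : EqOn (fun t => if t ≤ b then γ₁ t else γ₂ t) γ₁ (Icc a b) := fun t ht => if_pos ht.2
  have e₂ : EqOn (fun t => if t ≤ b then γ₁ t else γ₂ t) γ₂ (Icc b c) := by
    intro t ht
    rcases ht.1.eq_or_lt with rfl | h
    · simp [hb]
    · exact if_neg h.not_ge
  intro t ht
  rw [← Icc_union_Icc_eq_Icc hab hbc]
  have left : t ≤ b → HasDerivWithinAt (fun t => if t ≤ b then γ₁ t else γ₂ t)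
      (v t (if t ≤ b then γ₁ t else γ₂ t)) (Icc a b) t := fun h => by
    rw [if_pos h]
    exact (h₁ t ⟨ht.1, h⟩).congr_of_mem e₁ ⟨ht.1, h⟩
  have right : b ≤ t → HasDerivWithinAt (fun t => if t ≤ b then γ₁ t else γ₂ t)
      (v t (if t ≤ b then γ₁ t else γ₂ t)) (Icc b c) t := fun h => by
    rw [show (if t ≤ b then γ₁ t else γ₂ t) = γ₂ t from e₂ ⟨h, ht.2⟩]
    exact (h₂ t ⟨h, ht.2⟩).congr_of_mem e₂ ⟨h, ht.2⟩
  rcases lt_trichotomy t b with h | h | h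
  · exact (left h.le).union (HasFDerivWithinAt.of_notMem_closure (by simp [h]))
  · exact (left h.le).union (right h.ge)
  · exact HasDerivWithinAt.union (HasFDerivWithinAt.of_notMem_closure (by simp [h])) (right h.le)

open scoped NNReal in
/-- A linear differential equation with continuous coefficients has a solution on the whole
interval. -/
theorem exists_isIntegralCurveOn_linear {E : Type*} [NormedAddCommGroup E] [NormedSpace ℝ E]
    [CompleteSpace E] {A : ℝ → E →L[ℝ] E} {T : ℝ} (hT : 0 ≤ T) (hA : ContinuousOn A (Icc 0 T))
    (x : E) : ∃ γ : ℝ → E, γ 0 = x ∧ IsIntegralCurveOn γ (fun t y => A t y) (Icc 0 T) := by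
  obtain ⟨K, hK⟩ : ∃ K : ℝ≥0, ∀ t ∈ Icc 0 T, ‖A t‖ ≤ K := by
    obtain ⟨C, hC⟩ := isCompact_Icc.exists_bound_of_continuousOn hA
    exact ⟨C.toNNReal, fun t ht => (hC t ht).trans (Real.le_coe_toNNReal C)⟩
  -- Picard–Lindelöf on the ball of radius `‖y‖ + 1` about `y`, where the speed is at most `K * (2 *
  -- ‖y‖ + 1) ≤ (2 * K + 1) * (‖y‖ + 1)`. The admissible length `1 / (2 * K + 1)` does not depend on
  -- `y`, so finitely many steps reach `T`.
  have step : ∀ a b : ℝ, 0 ≤ a → a ≤ b → b ≤ T → (2 * K + 1) * (b - a) ≤ 1 → ∀ y : E,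
      ∃ γ : ℝ → E, γ a = y ∧ IsIntegralCurveOn γ (fun t y => A t y) (Icc a b) := by
    intro a b ha hab hb hlen y
    have hsub : Icc a b ⊆ Icc 0 T := Icc_subset_Icc ha hb
    have hpl : IsPicardLindelof (fun t y => A t y) (⟨a, left_mem_Icc.2 hab⟩ : Icc a b) y
        (‖y‖₊ + 1) 0 (K * (2 * ‖y‖₊ + 1)) K := by
      refine ⟨fun t ht => ?_, fun z _ => ?_, fun t ht z hz => ?_, ?_⟩
      · exact ((A t).lipschitz.weaken (by exact_mod_cast hK t (hsub ht))).lipschitzOnWith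
      · exact (hA.mono hsub).clm_apply continuousOn_const
      · have h1 : ‖z‖ ≤ 2 * ‖y‖ + 1 := by
          have := norm_le_of_mem_closedBall hz
          push_cast [coe_nnnorm] at this
          linarith
        calc ‖A t z‖ ≤ ‖A t‖ * ‖z‖ := (A t).le_opNorm z
          _ ≤ K * (2 * ‖y‖ + 1) := by gcongr; exact hK t (hsub ht)
          _ = _ := by push_cast; rfl
      · have hd : 0 ≤ b - a := by linarith
        simp only [sub_self, max_eq_left hd]
        push_cast
        have h2 := mul_le_mul_of_nonneg_left hlen (show (0 : ℝ) ≤ ‖y‖ + 1 by positivity)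
        have h3 : 0 ≤ (K : ℝ) * (b - a) := by positivity
        have h4 : 0 ≤ ‖y‖ * (b - a) := by positivity
        nlinarith
    obtain ⟨γ, h1, h2⟩ := hpl.exists_eq_forall_mem_Icc_hasDerivWithinAt₀
    exact ⟨γ, h1, h2⟩
  obtain ⟨n, hn⟩ := exists_nat_ge ((2 * K + 1) * T)
  have main : ∀ k : ℕ, ∃ γ : ℝ → E, γ 0 = x ∧
      IsIntegralCurveOn γ (fun t y => A t y) (Icc 0 (min T (k / (2 * K + 1)))) := by
    have hpos : (0 : ℝ) < 2 * K + 1 := by positivity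
    intro k
    induction k with
    | zero =>
      obtain ⟨γ, h1, h2⟩ := step 0 0 le_rfl le_rfl hT (by simp) x
      exact ⟨γ, h1, by simpa [hT] using h2⟩
    | succ k ih =>
      obtain ⟨γ₁, h0, h1⟩ := ih
      set b := min T ((k : ℝ) / (2 * K + 1))
      set c := min T (((k + 1 : ℕ) : ℝ) / (2 * K + 1)) with hc
      have hb0 : 0 ≤ b := le_min hT (by positivity)
      have hbc : b ≤ c := min_le_min le_rfl (by gcongr; simp)
      have hcb : c ≤ b + 1 / (2 * K + 1) := by
        rw [← min_add_add_right]
        refine le_min ((min_le_left _ _).trans (by simp; positivity)) ((min_le_right _ _).trans ?_)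
        push_cast; rw [add_div]
      have hlen : (2 * K + 1) * (c - b) ≤ 1 := by
        calc (2 * K + 1) * (c - b) ≤ (2 * K + 1) * (1 / (2 * K + 1)) := by gcongr; linarith
          _ = 1 := by field_simp
      obtain ⟨γ₂, h2, h3⟩ := step b c hb0 hbc (min_le_left _ _) hlen (γ₁ b)
      exact ⟨_, by simp [hb0, h0], h1.ite hb0 hbc h3 h2.symm⟩
  obtain ⟨γ, h0, h1⟩ := main n
  refine ⟨γ, h0, ?_⟩
  rwa [min_eq_left] at h1
  rw [le_div_iff₀ (by positivity)]; linarith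

open Metric Topology in
/-- **Differentiability of a flow with respect to the initial value.** The derivative is the value
at the final time of the solution of the variational equation. -/
theorem exists_hasStrictFDerivAt_flow {E : Type*} [NormedAddCommGroup E] [NormedSpace ℝ E]
    [CompleteSpace E] {v : E → E} {Ω U : Set E} {T : ℝ} {Φ : ℝ → E → E} (hT : 0 ≤ T)
    (hΩ : IsOpen Ω) (hv : ContDiffOn ℝ 1 v Ω) (hU : IsOpen U)
    (h0 : ∀ x ∈ U, Φ 0 x = x) (hmem : ∀ x ∈ U, ∀ t ∈ Icc 0 T, Φ t x ∈ Ω)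
    (hode : ∀ x ∈ U, IsIntegralCurveOn (fun t => Φ t x) (fun _ => v) (Icc 0 T))
    {x : E} (hx : x ∈ U) :
    ∃ M : ℝ → E →L[ℝ] E, M 0 = .id ℝ E ∧
      (∀ t ∈ Icc 0 T, HasDerivWithinAt M ((fderiv ℝ v (Φ t x)).comp (M t)) (Icc 0 T) t) ∧
      HasStrictFDerivAt (Φ T) (M T) x := by
  have hγ : ContinuousOn (fun t => Φ t x) (Icc 0 T) := (hode x hx).continuousOn
  have hA : ContinuousOn (fun t => fderiv ℝ v (Φ t x)) (Icc 0 T) :=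
    (hv.continuousOn_fderiv_of_isOpen hΩ le_rfl).comp hγ (hmem x hx)
  -- The variational equation is linear on the space of operators: its coefficient is left
  -- composition with the derivative of `v`.
  obtain ⟨M, hM0, hM⟩ := exists_isIntegralCurveOn_linear hT
    (A := fun t => ContinuousLinearMap.compL ℝ E E E (fderiv ℝ v (Φ t x)))
    ((ContinuousLinearMap.continuous _).comp_continuousOn hA) (.id ℝ E)
  refine ⟨M, hM0, hM, ?_⟩
  obtain ⟨C, hC⟩ := isCompact_Icc.exists_bound_of_continuousOn hA
  have hC0 : 0 ≤ C := (norm_nonneg _).trans (hC 0 (left_mem_Icc.2 hT))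
  have hK := isCompact_Icc.image_of_continuousOn hγ
  have hKΩ : (fun t => Φ t x) '' Icc 0 T ⊆ Ω := by rintro _ ⟨t, ht, rfl⟩; exact hmem x hx t ht
  -- `C` bounds the derivative along the trajectory, `C + 1` is a Lipschitz constant in a tube
  -- around it, and one more unit gives the strict gap for the barrier.
  set e := Real.exp ((C + 2) * T) with he
  have he0 : 0 < e := Real.exp_pos _
  have hexp : ∀ t ∈ Icc 0 T, Real.exp ((C + 2) * t) ≤ e := fun t ht => by
    rw [he]; gcongr; exact ht.2
  -- Near the given trajectory, trajectories depend Lipschitz continuously on the initial value.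
  have tube : ∀ ε > 0, ε ≤ 1 → ∃ η > 0, ∀ y ∈ ball x η, ∀ z ∈ ball x η, y ∈ U ∧ z ∈ U ∧
      ∀ t ∈ Icc 0 T, ‖Φ t y - Φ t z‖ ≤ ‖y - z‖ * e ∧
        ‖v (Φ t y) - v (Φ t z) - fderiv ℝ v (Φ t x) (Φ t y - Φ t z)‖
          ≤ ε * ‖Φ t y - Φ t z‖ := by
    intro ε hε hε1
    obtain ⟨δ, hδ, hδv⟩ := hv.exists_uniform_norm_sub_fderiv_le hΩ hK hKΩ hε
    have hvel : ∀ t ∈ Icc 0 T, ∀ a ∈ ball (Φ t x) δ, ∀ b ∈ ball (Φ t x) δ,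
        ‖v a - v b‖ ≤ (C + 1) * ‖a - b‖ := by
      intro t ht a ha b hb
      have h1 := hδv _ (mem_image_of_mem _ ht) a ha b hb
      have h2 := (fderiv ℝ v (Φ t x)).le_of_opNorm_le (hC t ht) (a - b)
      have h3 := norm_add_le (v a - v b - fderiv ℝ v (Φ t x) (a - b)) (fderiv ℝ v (Φ t x) (a - b))
      rw [sub_add_cancel] at h3
      have h4 := mul_le_mul_of_nonneg_right hε1 (norm_nonneg (a - b))
      linarith
    obtain ⟨r, hr, hrU⟩ := Metric.isOpen_iff.1 hU x hx
    -- The starting radius `δ / (2 * e)` keeps the barrier below `δ` up to time `T`. At a contact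
    -- the curve is therefore still in the tube, where `hvel` applies, so no circularity arises.
    have hstay : ∀ y ∈ ball x (min r (δ / (2 * e))), ∀ t ∈ Icc 0 T, Φ t y ∈ ball (Φ t x) δ := by
      intro y hy t ht
      have hyU : y ∈ U := hrU (ball_subset_ball (min_le_left _ _) hy)
      have hyδ : ‖y - x‖ ≤ δ / (2 * e) := by
        rw [← dist_eq_norm]; exact ((mem_ball.1 hy).trans_le (min_le_right _ _)).le
      have hlt : ∀ s ∈ Icc 0 T, δ / (2 * e) * Real.exp ((C + 2) * s) < δ := by
        intro s hs
        calc δ / (2 * e) * Real.exp ((C + 2) * s) ≤ δ / (2 * e) * e := by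
              gcongr; exact hexp s hs
          _ = δ / 2 := by field_simp
          _ < δ := half_lt_self hδ
      rw [mem_ball, dist_eq_norm]
      refine lt_of_le_of_lt ?_ (hlt t ht)
      refine norm_le_mul_exp_of_norm_deriv_le (f := fun t => Φ t y - Φ t x) (c := C + 1)
        (by positivity) (by linarith)
        (fun s hs => (hode y hyU s hs).sub (hode x hx s hs)) ?_ ?_ t ht
      · simpa [h0 y hyU, h0 x hx] using hyδ
      · intro s hs heq
        rw [← heq]
        refine hvel s hs _ ?_ _ (mem_ball_self hδ)
        rw [mem_ball, dist_eq_norm, heq]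
        exact hlt s hs
    refine ⟨min r (δ / (2 * e)), by positivity, fun y hy z hz => ?_⟩
    have hyU : y ∈ U := hrU (ball_subset_ball (min_le_left _ _) hy)
    have hzU : z ∈ U := hrU (ball_subset_ball (min_le_left _ _) hz)
    refine ⟨hyU, hzU, fun t ht => ⟨?_, hδv _ (mem_image_of_mem _ ht) _ (hstay y hy t ht) _
      (hstay z hz t ht)⟩⟩
    rcases eq_or_ne y z with rfl | hyz
    · simp
    have hpos : 0 < ‖y - z‖ := norm_pos_iff.2 (sub_ne_zero.2 hyz)
    refine (norm_le_mul_exp_of_norm_deriv_le (f := fun t => Φ t y - Φ t z) (c := C + 1)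
      (L := C + 2) hpos (by linarith)
      (fun s hs => (hode y hyU s hs).sub (hode z hzU s hs)) ?_ ?_ t ht).trans ?_
    · simp [h0 y hyU, h0 z hzU]
    · intro s hs heq
      rw [← heq]
      exact hvel s hs _ (hstay y hy s hs) _ (hstay z hz s hs)
    · gcongr; exact hexp t ht
  rw [hasStrictFDerivAt_iff_isLittleO, Asymptotics.isLittleO_iff]
  intro c hc
  -- One factor `e` comes from the Lipschitz estimate in `tube`, the other from the barrier for the
  -- residual.
  obtain ⟨ε, hε, hε1, hεc⟩ : ∃ ε > 0, ε ≤ 1 ∧ ε * e * e ≤ c := by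
    refine ⟨min 1 (c / (e * e)), by positivity, min_le_left _ _, ?_⟩
    calc min 1 (c / (e * e)) * e * e ≤ c / (e * e) * e * e := by gcongr; exact min_le_right _ _
      _ = c := by field_simp
  obtain ⟨η, hη, htube⟩ := tube ε hε hε1
  have hnhds : ball x η ×ˢ ball x η ∈ 𝓝 (x, x) :=
    prod_mem_nhds (ball_mem_nhds x hη) (ball_mem_nhds x hη)
  filter_upwards [hnhds]
  rintro ⟨y, z⟩ ⟨hy, hz⟩
  obtain ⟨hyU, hzU, hyz⟩ := htube y hy z hz
  rcases eq_or_ne y z with rfl | hne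
  · simp
  have hpos : 0 < ‖y - z‖ := norm_pos_iff.2 (sub_ne_zero.2 hne)
  -- The residual starts at `0` and solves the variational equation up to an error at most `ε * e *
  -- ‖y - z‖`; on the barrier its speed is thus at most `C + 1` times the barrier. Since both `y`
  -- and `z` vary, the derivative is strict.
  have hres : ∀ t ∈ Icc 0 T, ‖Φ t y - Φ t z - M t (y - z)‖ ≤
      (ε * e * ‖y - z‖) * Real.exp ((C + 2) * t) := by
    refine norm_le_mul_exp_of_norm_deriv_le (f := fun t => Φ t y - Φ t z - M t (y - z))
      (f' := fun t => v (Φ t y) - v (Φ t z) - (fderiv ℝ v (Φ t x)).comp (M t) (y - z))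
      (c := C + 1) (by positivity) (by linarith) (fun t ht => ?_) ?_ (fun t ht heq => ?_)
    · exact ((hode y hyU t ht).sub (hode z hzU t ht)).sub
        ((hM t ht).clm_apply (hasDerivWithinAt_const _ _ (y - z)) |>.congr_deriv (by simp))
    · simp only [h0 y hyU, h0 z hzU, hM0, ContinuousLinearMap.id_apply, sub_self, norm_zero]
      positivity
    · obtain ⟨h1, h2⟩ := hyz t ht
      have h3 := (fderiv ℝ v (Φ t x)).le_of_opNorm_le (hC t ht) (Φ t y - Φ t z - M t (y - z))
      have h4 : ε * ‖Φ t y - Φ t z‖ ≤ ε * e * ‖y - z‖ := by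
        rw [mul_assoc, mul_comm e]; gcongr
      have h5 : ε * e * ‖y - z‖ ≤ ε * e * ‖y - z‖ * Real.exp ((C + 2) * t) := by
        refine le_mul_of_one_le_right (by positivity) (Real.one_le_exp ?_)
        have := ht.1
        positivity
      have h6 : v (Φ t y) - v (Φ t z) - (fderiv ℝ v (Φ t x)).comp (M t) (y - z) =
          (v (Φ t y) - v (Φ t z) - fderiv ℝ v (Φ t x) (Φ t y - Φ t z)) +
            fderiv ℝ v (Φ t x) (Φ t y - Φ t z - M t (y - z)) := by
        simp only [ContinuousLinearMap.comp_apply, map_sub]; abel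
      rw [h6]
      refine (norm_add_le _ _).trans ?_
      rw [heq] at h3
      linarith
  refine (hres T (right_mem_Icc.2 hT)).trans ?_
  rw [← he]
  calc ε * e * ‖y - z‖ * e = (ε * e * e) * ‖y - z‖ := by ring
    _ ≤ c * ‖y - z‖ := by gcongr

open Filter Topology in
/-- A map that is strictly differentiable at every point of an open set is `C¹` there. -/
theorem contDiffOn_one_of_hasStrictFDerivAt {E F : Type*} [NormedAddCommGroup E]
    [NormedSpace ℝ E] [NormedAddCommGroup F] [NormedSpace ℝ F] {f : E → F} {f' : E → E →L[ℝ] F}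
    {U : Set E} (hU : IsOpen U) (hf : ∀ x ∈ U, HasStrictFDerivAt f (f' x) x) :
    ContDiffOn ℝ 1 f U := by
  have hcont : ContinuousOn f' U := by
    intro x hx
    refine ContinuousAt.continuousWithinAt (Metric.tendsto_nhds.2 fun ε hε => ?_)
    have h := (hasStrictFDerivAt_iff_isLittleO.1 (hf x hx)).def (half_pos hε)
    have hdiag : Tendsto (fun y : E => (y, y)) (𝓝 x) (𝓝 (x, x)) :=
      Continuous.tendsto (by fun_prop) x
    filter_upwards [hdiag.eventually h.eventually_nhds, hU.mem_nhds hx] with y hy hyU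
    refine lt_of_le_of_lt ?_ (half_lt_self hε)
    rw [dist_eq_norm]
    -- Strict differentiability at `x` makes `f - f' x` Lipschitz with constant `ε / 2` near `x`,
    -- which bounds its derivative `f' y - f' x` at `y`.
    refine ((hf y hyU).hasFDerivAt.sub (f' x).hasFDerivAt).le_of_lip' (by positivity) ?_
    filter_upwards [hy.curry_nhds.self_of_nhds] with z hz
    rw [norm_sub_rev, norm_sub_rev z]
    rwa [Pi.sub_apply, Pi.sub_apply, sub_sub_sub_comm, ← map_sub]
  have h1 : ContDiffOn ℝ (0 + 1) f U := by
    rw [contDiffOn_succ_iff_fderiv_of_isOpen hU]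
    refine ⟨fun x hx => (hf x hx).hasFDerivAt.differentiableAt.differentiableWithinAt, by simp, ?_⟩
    rw [contDiffOn_zero]
    exact hcont.congr fun x hx => (hf x hx).hasFDerivAt.fderiv
  simpa using h1

/-! ### The Poincaré lemma on simply connected open sets. -/

open Topology in
/-- On a simply connected space, functions given on the members of an open cover that differ by
locally constant functions can be adjusted by locally constant functions to agree. -/
theorem SimplyConnectedSpace.exists_eventually_sub_eq {X F : Type*} [TopologicalSpace X]
    [SimplyConnectedSpace X] [LocallyPathConnectedSpace X] [AddCommGroup F]
    {V : X → Set X} (hV : ∀ i, IsOpen (V i)) (hmem : ∀ i, i ∈ V i) {f : X → X → F}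
    (hf : ∀ i j, ∀ x ∈ V i ∩ V j, ∀ᶠ y in 𝓝 x, f i y - f j y = f i x - f j x) :
    ∃ g : X → F, ∀ i, ∀ x ∈ V i, ∀ᶠ y in 𝓝 x, g y - f i y = g x - f i x := by
  let : TopologicalSpace F := ⊥
  have : DiscreteTopology F := ⟨rfl⟩
  -- The coordinate in chart `i` stands for `g - f i`, so passing to chart `j` adds `f i - f j`.
  -- With discrete fibres these locally constant transitions are continuous and the bundle is a
  -- covering; lifting the identity gives a global section, which encodes `g`.
  let Z : FiberBundleCore X X F :=
    { baseSet := V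
      isOpen_baseSet := hV
      indexAt := id
      mem_baseSet_at := hmem
      coordChange := fun i j x c => c + (f i x - f j x)
      coordChange_self := fun i x _ c => by simp
      continuousOn_coordChange := fun i j => by
        rintro ⟨x, c⟩ ⟨hx, -⟩
        refine ContinuousAt.continuousWithinAt ?_
        refine (continuousAt_const (y := c + (f i x - f j x))).congr ?_
        have h2 : ∀ᶠ p : X × F in 𝓝 (x, c), p.2 = c :=
          continuousAt_snd.eventually ((isOpen_discrete {c}).mem_nhds (mem_singleton c))
        filter_upwards [continuousAt_fst.eventually (hf i j x hx), h2] with p h3 h4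
        rw [h3, h4]
      coordChange_comp := fun i j k x _ c => by abel }
  have cov : IsCoveringMap Z.proj := FiberBundle.isCoveringMap (F := F) (E := Z.Fiber)
  obtain ⟨x₀⟩ : Nonempty X := inferInstance
  obtain ⟨σ, ⟨-, hσ⟩, -⟩ := cov.existsUnique_continuousMap_lifts (ContinuousMap.id X) x₀
    (⟨x₀, (0 : F)⟩ : Z.TotalSpace) rfl
  have hσ' (x : X) : Z.proj (σ x) = x := congrFun hσ x
  let c (x : X) : F := (σ x).snd
  refine ⟨fun x => c x + f x x, fun i x hx => ?_⟩
  have hchart (y : X) : (Z.localTriv i (σ y)).2 = (c y + f y y) - f i y := by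
    rw [FiberBundleCore.localTriv_apply, add_sub_assoc]
    change c y + (f (Z.proj (σ y)) (Z.proj (σ y)) - f i (Z.proj (σ y))) = _
    rw [hσ']
  have hcont : ContinuousAt (fun y => (Z.localTriv i (σ y)).2) x := by
    have h1 : ContinuousAt (Z.localTriv i) (σ x) :=
      (Z.localTriv i).continuousAt (by
        rw [FiberBundleCore.mem_localTriv_source]
        change Z.proj (σ x) ∈ V i
        rwa [hσ'])
    exact continuousAt_snd.comp (h1.comp σ.continuous.continuousAt)
  filter_upwards [hcont.eventually ((isOpen_discrete {(Z.localTriv i (σ x)).2}).mem_nhds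
    (mem_singleton _))] with y hy
  rw [← hchart, ← hchart]
  exact hy

open Metric in
/-- **Poincaré lemma** for closed `1`-forms on simply connected open sets. -/
theorem IsSimplyConnected.exists_forall_hasFDerivAt_of_fderiv_symmetric {E F : Type*}
    [NormedAddCommGroup E] [NormedSpace ℝ E] [NormedAddCommGroup F] [NormedSpace ℝ F]
    [CompleteSpace F] {s : Set E} (hs : IsSimplyConnected s) (hso : IsOpen s)
    {ω : E → E →L[ℝ] F} (hω : DifferentiableOn ℝ ω s)
    (hdω : ∀ a ∈ s, ∀ x y, fderiv ℝ ω a x y = fderiv ℝ ω a y x) :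
    ∃ f : E → F, ∀ a ∈ s, HasFDerivAt f (ω a) a := by
  have := hs.simplyConnectedSpace
  have := hso.locallyPathConnectedSpace
  choose! r hr hrs using Metric.isOpen_iff.1 hso
  have hloc (i : s) : ∃ f : E → F, ∀ a ∈ ball (i : E) (r i), HasFDerivAt f (ω a) a :=
    (convex_ball _ _).exists_forall_hasFDerivAt_of_fderiv_symmetric isOpen_ball
      (hω.mono (hrs i i.2)) fun a ha => hdω a (hrs i i.2 ha)
  choose f hf using hloc
  obtain ⟨g, hg⟩ := SimplyConnectedSpace.exists_eventually_sub_eq (X := s) (F := F)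
    (V := fun i => Subtype.val ⁻¹' ball (i : E) (r i)) (f := fun i x => f i x)
    (fun i => isOpen_ball.preimage continuous_subtype_val) (fun i => mem_ball_self (hr i i.2)) (by
      rintro i j x ⟨hi, hj⟩
      have hopen : IsOpen (ball (i : E) (r i) ∩ ball (j : E) (r j)) := isOpen_ball.inter isOpen_ball
      have hd : ∀ a ∈ ball (i : E) (r i) ∩ ball (j : E) (r j),
          HasFDerivAt (fun x => f i x - f j x) 0 a := fun a ha => by
        simpa using (hf i a ha.1).fun_sub (hf j a ha.2)
      filter_upwards [(hopen.preimage continuous_subtype_val).mem_nhds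
        (show x ∈ Subtype.val ⁻¹' (ball (i : E) (r i) ∩ ball (j : E) (r j)) from ⟨hi, hj⟩)] with y hy
      -- Two balls meet in a convex set, so two primitives differ by a single constant there.
      exact hopen.is_const_of_fderiv_eq_zero (𝕜 := ℝ)
        ((convex_ball _ _).inter (convex_ball _ _)).isPreconnected
        (fun a ha => (hd a ha).differentiableAt.differentiableWithinAt)
        (fun a ha => (hd a ha).fderiv) hy ⟨hi, hj⟩)
  classical
  refine ⟨fun x => if hx : x ∈ s then g ⟨x, hx⟩ else 0, fun a ha => ?_⟩
  have h1 := hg ⟨a, ha⟩ ⟨a, ha⟩ (mem_ball_self (hr a ha))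
  rw [nhds_subtype_eq_comap, Filter.eventually_comap] at h1
  refine ((hf ⟨a, ha⟩ a (mem_ball_self (hr a ha))).add_const
    (g ⟨a, ha⟩ - f ⟨a, ha⟩ a)).congr_of_eventuallyEq ?_
  filter_upwards [h1, hso.mem_nhds ha] with y hy hys
  rw [dif_pos hys, ← hy ⟨y, hys⟩ rfl]
  abel

/-! ### Hamiltonian flows are symplectic; gradient fields and their potentials. -/

section Gradient

variable {E : Type*} [NormedAddCommGroup E] [InnerProductSpace ℝ E] [CompleteSpace E]

/-- The differential of a gradient field is the Hessian. -/
theorem inner_fderiv_gradient {H : E → ℝ} {y : E} (hH : ContDiffAt ℝ 2 H y)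
    (a b : E) : inner ℝ (fderiv ℝ (gradient H) y a) b = fderiv ℝ (fderiv ℝ H) y a b := by
  have h1 : DifferentiableAt ℝ (fderiv ℝ H) y :=
    (hH.fderiv_right (m := 1) le_rfl).differentiableAt one_ne_zero
  have h2 : DifferentiableAt ℝ (gradient H) y :=
    ((InnerProductSpace.toDual ℝ E).symm.contDiff (n := 1)).differentiable one_ne_zero
      |>.differentiableAt.comp y h1
  have h3 : HasFDerivAt (fun z => innerSL ℝ (gradient H z))
      ((innerSL ℝ).comp (fderiv ℝ (gradient H) y)) y :=
    (innerSL ℝ).hasFDerivAt.comp y h2.hasFDerivAt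
  have h4 : fderiv ℝ H = fun z => innerSL ℝ (gradient H z) := by
    ext z c
    exact (InnerProductSpace.toDual_symm_apply (y := fderiv ℝ H z)).symm
  conv_rhs => rw [h4, h3.fderiv]
  rfl

/-- The gradient of a `C²` function is `C¹`. -/
theorem ContDiffOn.gradient_of_isOpen {H : E → ℝ} {Ω : Set E} (hΩ : IsOpen Ω)
    (hH : ContDiffOn ℝ 2 H Ω) : ContDiffOn ℝ 1 (gradient H) Ω :=
  (InnerProductSpace.toDual ℝ E).symm.contDiff.comp_contDiffOn
    (hH.fderiv_of_isOpen hΩ le_rfl)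

/-- The time-`T` map of the flow of `ẋ = J ∇H(x)` is `C¹`, and it preserves the symplectic form
`(a, b) ↦ ⟪J a, b⟫`. -/
theorem contDiffOn_and_symplectic_flow {J : E →L[ℝ] E}
    (hJ : ∀ a b, inner ℝ (J a) (J b) = inner ℝ a b) (hJJ : ∀ a, J (J a) = -a)
    {H : E → ℝ} {Ω U : Set E} {T : ℝ} {Φ : ℝ → E → E} (hT : 0 ≤ T) (hΩ : IsOpen Ω)
    (hH : ContDiffOn ℝ 2 H Ω) (hU : IsOpen U)
    (h0 : ∀ x ∈ U, Φ 0 x = x) (hmem : ∀ x ∈ U, ∀ t ∈ Icc 0 T, Φ t x ∈ Ω)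
    (hode : ∀ x ∈ U, IsIntegralCurveOn (fun t => Φ t x) (fun _ y => J (gradient H y)) (Icc 0 T)) :
    ContDiffOn ℝ 1 (Φ T) U ∧ ∀ x ∈ U, ∀ a b,
      inner ℝ (J (fderiv ℝ (Φ T) x a)) (fderiv ℝ (Φ T) x b) = inner ℝ (J a) b := by
  have hg := hH.gradient_of_isOpen hΩ
  have hv : ContDiffOn ℝ 1 (fun y => J (gradient H y)) Ω := J.contDiff.comp_contDiffOn hg
  choose! M hM0 hM hΦM using fun x (hx : x ∈ U) =>
    exists_hasStrictFDerivAt_flow hT hΩ hv hU h0 hmem hode hx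
  refine ⟨contDiffOn_one_of_hasStrictFDerivAt hU hΦM, fun x hx a b => ?_⟩
  rw [(hΦM x hx).hasFDerivAt.fderiv]
  have hA : ∀ t ∈ Icc 0 T, ∀ c, fderiv ℝ (fun y => J (gradient H y)) (Φ t x) c =
      J (fderiv ℝ (gradient H) (Φ t x) c) := by
    intro t ht c
    have hd : DifferentiableAt ℝ (gradient H) (Φ t x) :=
      (hg.differentiableOn one_ne_zero).differentiableAt (hΩ.mem_nhds (hmem x hx t ht))
    have : HasFDerivAt (fun y => J (gradient H y))
        (J.comp (fderiv ℝ (gradient H) (Φ t x))) (Φ t x) :=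
      J.hasFDerivAt.comp _ hd.hasFDerivAt
    rw [this.fderiv, ContinuousLinearMap.comp_apply]
  -- With `A` the Hessian and `M' = J A M`, the derivative is `⟪J J A M a, M b⟫ + ⟪J M a, J A M b⟫ =
  -- -⟪A M a, M b⟫ + ⟪M a, A M b⟫`, which vanishes by symmetry of `A`.
  have hderiv : ∀ t ∈ Icc 0 T,
      HasDerivWithinAt (fun t => inner ℝ (J (M x t a)) (M x t b)) 0 (Icc 0 T) t := by
    intro t ht
    have hMc (c : E) : HasDerivWithinAt (fun t => M x t c)
        (J (fderiv ℝ (gradient H) (Φ t x) (M x t c))) (Icc 0 T) t := by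
      refine ((hM x hx t ht).clm_apply (hasDerivWithinAt_const _ _ c)).congr_deriv ?_
      simp [hA t ht]
    have h1 : HasDerivWithinAt (fun t => J (M x t a)) _ (Icc 0 T) t :=
      J.hasFDerivAt.comp_hasDerivWithinAt t (hMc a)
    refine (h1.inner ℝ (hMc b)).congr_deriv ?_
    have hHt : ContDiffAt ℝ 2 H (Φ t x) := hH.contDiffAt (hΩ.mem_nhds (hmem x hx t ht))
    rw [hJ, hJJ, inner_neg_left, real_inner_comm,
      inner_fderiv_gradient hHt, inner_fderiv_gradient hHt,
      hHt.isSymmSndFDerivAt (by simp) (M x t a), add_neg_cancel]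
  have := constant_of_has_deriv_right_zero (fun t ht => (hderiv t ht).continuousWithinAt)
    (fun t ht => (hderiv t (Ico_subset_Icc_self ht)).mono_of_mem_nhdsWithin
      (Icc_mem_nhdsGE_of_mem ht)) T (right_mem_Icc.2 hT)
  simpa [hM0 x hx] using this

/-- A `C¹` vector field with a symmetric differential on a simply connected open set is the
gradient of a `C¹` function. -/
theorem IsSimplyConnected.exists_hasGradientAt {W : Set E} (hWsc : IsSimplyConnected W)
    (hW : IsOpen W) {G : E → E} (hG : ContDiffOn ℝ 1 G W)
    (hsymm : ∀ w ∈ W, ∀ a b, inner ℝ (fderiv ℝ G w a) b = inner ℝ (fderiv ℝ G w b) a) :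
    ∃ S : E → ℝ, ContDiffOn ℝ 1 S W ∧ ∀ w ∈ W, HasGradientAt S (G w) w := by
  have hω : ContDiffOn ℝ 1 (fun w => innerSL ℝ (G w)) W := (innerSL ℝ).contDiff.comp_contDiffOn hG
  have hdω : ∀ w ∈ W, ∀ a b, fderiv ℝ (fun w => innerSL ℝ (G w)) w a b =
      fderiv ℝ (fun w => innerSL ℝ (G w)) w b a := fun w hw a b => by
    have hd : HasFDerivAt (fun w => innerSL ℝ (G w)) ((innerSL ℝ).comp (fderiv ℝ G w)) w :=
      (innerSL ℝ).hasFDerivAt.comp w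
        ((hG.differentiableOn one_ne_zero).differentiableAt (hW.mem_nhds hw)).hasFDerivAt
    rw [hd.fderiv]
    exact hsymm w hw a b
  obtain ⟨S, hS⟩ := hWsc.exists_forall_hasFDerivAt_of_fderiv_symmetric hW
    (hω.differentiableOn one_ne_zero) hdω
  refine ⟨S, ?_, fun w hw => hasGradientAt_iff_hasFDerivAt.2 (hS w hw)⟩
  have : ContDiffOn ℝ (0 + 1) S W := by
    rw [contDiffOn_succ_iff_fderiv_of_isOpen hW]
    refine ⟨fun w hw => (hS w hw).differentiableAt.differentiableWithinAt, by simp, ?_⟩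
    exact (hω.of_le zero_le_one).congr fun w hw => (hS w hw).fderiv
  simpa using this

/-- Functions with the same gradient on a connected open set differ by a constant. -/
theorem IsPreconnected.exists_eq_add_const_of_hasGradientAt {W : Set E} (hWc : IsPreconnected W)
    (hW : IsOpen W) {G : E → E} {S S' : E → ℝ} (hS : ∀ w ∈ W, HasGradientAt S (G w) w)
    (hS' : ∀ w ∈ W, HasGradientAt S' (G w) w) : ∃ c : ℝ, ∀ w ∈ W, S' w = S w + c := by
  have hd : ∀ w ∈ W, HasFDerivAt (fun w => S' w - S w) 0 w := fun w hw => by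
    simpa using (hS' w hw).hasFDerivAt.fun_sub (hS w hw).hasFDerivAt
  obtain ⟨c, hc⟩ := hW.exists_is_const_of_fderiv_eq_zero (𝕜 := ℝ) hWc
    (fun w hw => (hd w hw).differentiableAt.differentiableWithinAt) (fun w hw => (hd w hw).fderiv)
  exact ⟨c, fun w hw => by rw [← hc w hw]; ring⟩

end Gradient

/-! ### Closedness of the mixed form `p dq + Q dP`. -/

section Lagrangian

variable {E V : Type*} [NormedAddCommGroup E] [NormedSpace ℝ E] [NormedAddCommGroup V]
  [InnerProductSpace ℝ V]

/-- Let `π₁` and `π₂` be the position and the momentum on `E`, let `F` be symplectic, and let `g`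
be an inverse of the map `x ↦ (π₁ x, π₂ (F x))`. Then the `1`-form `⟪π₂ g, dπ₁⟫ + ⟪π₁ (F ∘ g), dπ₂⟫`
is closed. -/
theorem symmetric_mixed_of_symplectic {π₁ π₂ : E →L[ℝ] V} {F g : E → E} {U W : Set E}
    (hU : IsOpen U) (hW : IsOpen W) (hF : ContDiffOn ℝ 1 F U) (hg : ContDiffOn ℝ 1 g W)
    (hgU : MapsTo g W U)
    (hFsymp : ∀ x ∈ U, ∀ a b,
      inner ℝ (π₂ (fderiv ℝ F x a)) (π₁ (fderiv ℝ F x b)) -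
        inner ℝ (π₁ (fderiv ℝ F x a)) (π₂ (fderiv ℝ F x b)) =
      inner ℝ (π₂ a) (π₁ b) - inner ℝ (π₁ a) (π₂ b))
    (h₁ : ∀ w ∈ W, π₁ (g w) = π₁ w) (h₂ : ∀ w ∈ W, π₂ (F (g w)) = π₂ w)
    {w : E} (hw : w ∈ W) (a b : E) :
    inner ℝ (fderiv ℝ (fun w => π₂ (g w)) w a) (π₁ b) +
        inner ℝ (fderiv ℝ (fun w => π₁ (F (g w))) w a) (π₂ b) =
      inner ℝ (fderiv ℝ (fun w => π₂ (g w)) w b) (π₁ a) +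
        inner ℝ (fderiv ℝ (fun w => π₁ (F (g w))) w b) (π₂ a) := by
  have hgw := ((hg.differentiableOn one_ne_zero).differentiableAt (hW.mem_nhds hw)).hasFDerivAt
  have hFw := ((hF.differentiableOn one_ne_zero).differentiableAt
    (hU.mem_nhds (hgU hw))).hasFDerivAt
  have hFg := hFw.comp w hgw
  have e1 : fderiv ℝ (fun w => π₂ (g w)) w = π₂.comp (fderiv ℝ g w) :=
    (π₂.hasFDerivAt.comp w hgw).fderiv
  have e2 : fderiv ℝ (fun w => π₁ (F (g w))) w =
      π₁.comp ((fderiv ℝ F (g w)).comp (fderiv ℝ g w)) :=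
    (π₁.hasFDerivAt.comp w hFg).fderiv
  have e3 : π₁.comp (fderiv ℝ g w) = π₁ :=
    (π₁.hasFDerivAt.comp w hgw).unique (π₁.hasFDerivAt.congr_of_eventuallyEq
      (Filter.eventuallyEq_of_mem (hW.mem_nhds hw) h₁))
  have e4 : π₂.comp ((fderiv ℝ F (g w)).comp (fderiv ℝ g w)) = π₂ :=
    (π₂.hasFDerivAt.comp w hFg).unique (π₂.hasFDerivAt.congr_of_eventuallyEq
      (Filter.eventuallyEq_of_mem (hW.mem_nhds hw) h₂))
  have f3 (c : E) : π₁ (fderiv ℝ g w c) = π₁ c := congrArg (fun L => L c) e3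
  have f4 (c : E) : π₂ (fderiv ℝ F (g w) (fderiv ℝ g w c)) = π₂ c :=
    congrArg (fun L => L c) e4
  -- Evaluated on `dg a` and `dg b`, symplecticity contains the old position and the new momentum
  -- only through `f3` and `f4`, which turn them into the coordinates of `a` and `b`. What remains
  -- is the claimed symmetry, rearranged.
  have key := hFsymp (g w) (hgU hw) (fderiv ℝ g w a) (fderiv ℝ g w b)
  simp only [f3, f4] at key
  rw [e1, e2]
  simp only [ContinuousLinearMap.comp_apply]
  rw [real_inner_comm (π₁ a), real_inner_comm (π₂ a)]
  linarith

/-- The derivative of the combination `ι (p, Q)` of two maps. -/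
theorem fderiv_clm_comp_prodMk {ι : V × V →L[ℝ] E} {p Q : E → V} {w : E}
    (hp : DifferentiableAt ℝ p w) (hQ : DifferentiableAt ℝ Q w) (a : E) :
    fderiv ℝ (fun w => ι (p w, Q w)) w a = ι (fderiv ℝ p w a, fderiv ℝ Q w a) := by
  have : HasFDerivAt (fun w => ι (p w, Q w)) (ι.comp ((fderiv ℝ p w).prod (fderiv ℝ Q w))) w :=
    ι.hasFDerivAt.comp w (hp.hasFDerivAt.prodMk hQ.hasFDerivAt)
  rw [this.fderiv]; rfl

end Lagrangian

/-! ### Phase space coordinates and partial gradients. -/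

section PhaseSpace

variable {n : ℕ}

@[simp] theorem pt_fst (q p : Config n) : (pt q p).fst = q := rfl

@[simp] theorem pt_snd (q p : Config n) : (pt q p).snd = p := rfl

@[simp] theorem pt_fst_snd (x : PhaseSpace n) : pt x.fst x.snd = x := rfl

theorem inner_pt (q p : Config n) (x : PhaseSpace n) :
    inner ℝ (pt q p) x = inner ℝ q x.fst + inner ℝ p x.snd := by
  simp [pt, WithLp.prod_inner_apply]

/-- The map `(q, p) ↦ pt q p` as a continuous linear map. -/
def ptL : Config n × Config n →L[ℝ] PhaseSpace n :=
  (WithLp.prodContinuousLinearEquiv 2 ℝ (Config n) (Config n)).symm.toContinuousLinearMap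

theorem ptL_apply (q p : Config n) : ptL (q, p) = pt q p := rfl

/-- The position as a continuous linear map. -/
def posL : PhaseSpace n →L[ℝ] Config n := WithLp.fstL 2 ℝ (Config n) (Config n)

/-- The momentum as a continuous linear map. -/
def momL : PhaseSpace n →L[ℝ] Config n := WithLp.sndL 2 ℝ (Config n) (Config n)

/-- The canonical matrix `J` as a continuous linear map. -/
def canonJL : PhaseSpace n →L[ℝ] PhaseSpace n := ptL.comp (momL.prod (-posL))

theorem canonJL_apply (x : PhaseSpace n) : canonJL x = canonJ x := rfl

theorem inner_canonJL_left (x y : PhaseSpace n) :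
    inner ℝ (canonJL x) y = inner ℝ x.snd y.fst - inner ℝ x.fst y.snd := by
  rw [canonJL_apply, canonJ, inner_pt, inner_neg_left, sub_eq_add_neg]

theorem inner_canonJL_canonJL (x y : PhaseSpace n) :
    inner ℝ (canonJL x) (canonJL y) = inner ℝ x y := by
  rw [inner_canonJL_left]
  simp [canonJL_apply, canonJ, WithLp.prod_inner_apply]
  ring

theorem canonJL_canonJL (x : PhaseSpace n) : canonJL (canonJL x) = -x := rfl

variable {W : Set (PhaseSpace n)}

/-- A function whose partial gradients are `p` and `Q` has the gradient `(p, Q)` wherever it is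
differentiable. -/
theorem hasGradientAt_pt {S : PhaseSpace n → ℝ} {w : PhaseSpace n} {p Q : Config n}
    (hS : DifferentiableAt ℝ S w)
    (hp : HasGradientAt (fun q : Config n => S (pt q w.snd)) p w.fst)
    (hQ : HasGradientAt (fun P : Config n => S (pt w.fst P)) Q w.snd) :
    HasGradientAt S (pt p Q) w := by
  rw [hasGradientAt_iff_hasFDerivAt] at *
  have h1 : HasFDerivAt (fun q : Config n => pt q w.snd) (ptL.comp (.inl ℝ _ _)) w.fst :=
    ptL.hasFDerivAt.comp w.fst (hasFDerivAt_prodMk_left w.fst w.snd)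
  have h2 : HasFDerivAt (fun P : Config n => pt w.fst P) (ptL.comp (.inr ℝ _ _)) w.snd :=
    ptL.hasFDerivAt.comp w.snd (hasFDerivAt_prodMk_right w.fst w.snd)
  have e1 := hp.unique (HasFDerivAt.comp (g := S) w.fst hS.hasFDerivAt h1)
  have e2 := hQ.unique (HasFDerivAt.comp (g := S) w.snd hS.hasFDerivAt h2)
  refine hS.hasFDerivAt.congr_fderiv (ContinuousLinearMap.ext fun a => ?_)
  have ha : a = pt a.fst 0 + pt 0 a.snd := by
    rw [← ptL_apply, ← ptL_apply, ← map_add]; simp [ptL_apply]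
  have e1' := congrArg (fun L => L a.fst) e1
  have e2' := congrArg (fun L => L a.snd) e2
  simp only [InnerProductSpace.toDual_apply_apply, ContinuousLinearMap.comp_apply,
    ContinuousLinearMap.inl_apply, ContinuousLinearMap.inr_apply, ptL_apply] at e1' e2'
  rw [InnerProductSpace.toDual_apply_apply, inner_pt, e1', e2', ← map_add, ← ha]

/-- The partial gradients of a function with the gradient `(p, Q)`. -/
theorem HasGradientAt.partial_gradients {S : PhaseSpace n → ℝ} {w : PhaseSpace n} {p Q : Config n}
    (hS : HasGradientAt S (pt p Q) w) :
    HasGradientAt (fun q : Config n => S (pt q w.snd)) p w.fst ∧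
      HasGradientAt (fun P : Config n => S (pt w.fst P)) Q w.snd := by
  simp only [hasGradientAt_iff_hasFDerivAt] at *
  have h1 : HasFDerivAt (fun q : Config n => pt q w.snd) (ptL.comp (.inl ℝ _ _)) w.fst :=
    ptL.hasFDerivAt.comp w.fst (hasFDerivAt_prodMk_left w.fst w.snd)
  have h2 : HasFDerivAt (fun P : Config n => pt w.fst P) (ptL.comp (.inr ℝ _ _)) w.snd :=
    ptL.hasFDerivAt.comp w.snd (hasFDerivAt_prodMk_right w.fst w.snd)
  refine ⟨(HasFDerivAt.comp (g := S) w.fst hS h1).congr_fderiv ?_,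
    (HasFDerivAt.comp (g := S) w.snd hS h2).congr_fderiv ?_⟩ <;>
  · ext1 a
    simp [ptL_apply]

/-- A function with the partial gradients `p` and `Q` on an open set has the gradient `(p, Q)`. -/
theorem IsPotential.hasGradientAt {p Q : PhaseSpace n → Config n} {S : PhaseSpace n → ℝ}
    (hW : IsOpen W) (hS : IsPotential W p Q S) {w : PhaseSpace n} (hw : w ∈ W) :
    HasGradientAt S (pt (p w) (Q w)) w :=
  hasGradientAt_pt ((hS.1.differentiableOn one_ne_zero).differentiableAt (hW.mem_nhds hw))
    (hS.2 w hw).1 (hS.2 w hw).2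

/-- A `C¹` vector field `(p, Q)` with a symmetric differential on a simply connected open set has a
potential. -/
theorem exists_isPotential (hW : IsOpen W) (hWsc : IsSimplyConnected W)
    {p Q : PhaseSpace n → Config n} (hp : ContDiffOn ℝ 1 p W) (hQ : ContDiffOn ℝ 1 Q W)
    (hsymm : ∀ w ∈ W, ∀ a b : PhaseSpace n,
      inner ℝ (fderiv ℝ p w a) b.fst + inner ℝ (fderiv ℝ Q w a) b.snd =
        inner ℝ (fderiv ℝ p w b) a.fst + inner ℝ (fderiv ℝ Q w b) a.snd) :
    ∃ S, IsPotential W p Q S := by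
  have hpQ : ContDiffOn ℝ 1 (fun w => ptL (p w, Q w)) W :=
    ptL.contDiff.comp_contDiffOn (hp.prodMk hQ)
  obtain ⟨S, hS, hgrad⟩ := hWsc.exists_hasGradientAt hW hpQ fun w hw a b => by
    have hpw := (hp.differentiableOn one_ne_zero).differentiableAt (hW.mem_nhds hw)
    have hQw := (hQ.differentiableOn one_ne_zero).differentiableAt (hW.mem_nhds hw)
    rw [fderiv_clm_comp_prodMk hpw hQw, fderiv_clm_comp_prodMk hpw hQw, ptL_apply, ptL_apply,
      inner_pt, inner_pt]
    exact hsymm w hw a b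
  exact ⟨S, hS, fun w hw => (hgrad w hw).partial_gradients⟩

/-- The gradient of `S^T` in terms of the gradient of `S`. -/
theorem HasGradientAt.typeII {S : PhaseSpace n → ℝ} {w : PhaseSpace n} {p Q : Config n}
    (hS : HasGradientAt S (pt p Q) w) (T : ℝ) :
    HasGradientAt (typeII T S) (T⁻¹ • pt (p - w.snd) (Q - w.fst)) w := by
  rw [hasGradientAt_iff_hasFDerivAt] at *
  -- The gradient of `⟪q, P⟫` is `(P, q)`, hence the shifts `p - P` and `Q - q`.
  have h1 : HasFDerivAt (fun w : PhaseSpace n => inner ℝ w.fst w.snd) _ w :=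
    (posL (n := n)).hasFDerivAt.inner ℝ (momL (n := n)).hasFDerivAt
  have h2 := (hS.fun_sub h1).const_mul T⁻¹
  have h3 : _root_.typeII T S = fun w => T⁻¹ * (S w - inner ℝ w.fst w.snd) := by
    funext w; rw [_root_.typeII, div_eq_inv_mul]
  rw [h3]
  refine h2.congr_fderiv (ContinuousLinearMap.ext fun a => ?_)
  have h4 : (fderivInnerCLM ℝ (posL w, w.snd)) ((posL (n := n)).prod momL a) =
      inner ℝ w.fst a.snd + inner ℝ a.fst w.snd := fderivInnerCLM_apply ℝ _ _
  rw [InnerProductSpace.toDual_apply_apply, real_inner_smul_left, inner_pt, inner_sub_left,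
    inner_sub_left]
  change T⁻¹ * (InnerProductSpace.toDual ℝ (PhaseSpace n) (pt p Q) a -
    (fderivInnerCLM ℝ (posL w, w.snd)) ((posL (n := n)).prod momL a)) = _
  rw [h4, InnerProductSpace.toDual_apply_apply, inner_pt, real_inner_comm a.fst w.snd]
  ring

end PhaseSpace

/-! ### The generating function. -/

theorem theorem3 (n : ℕ) (Ω : Set (PhaseSpace n)) (hΩ : IsOpen Ω)
    (H : PhaseSpace n → ℝ) (hH : ContDiffOn ℝ 2 H Ω)
    (T : ℝ) (hT : 0 < T)
    (U W : Set (PhaseSpace n)) (hU : IsOpen U) (hUΩ : U ⊆ Ω)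
    (Φ : ℝ → PhaseSpace n → PhaseSpace n) (hΦ : IsHamiltonianFlow H Ω U T Φ)
    (hD : ∀ x ∈ U, (blockD (Φ T) x).IsInvertible)
    (hW : IsOpen W) (hWsc : IsSimplyConnected W)
    (hΨ : IsDiffeoOn (mixedMap (Φ T)) U W) :
    ∃ p Q : PhaseSpace n → Config n,
      ContDiffOn ℝ 1 p W ∧ ContDiffOn ℝ 1 Q W ∧
      IsMixedRepresentation (Φ T) U W p Q ∧
      (∀ p' Q' : PhaseSpace n → Config n, IsMixedRepresentation (Φ T) U W p' Q' →
        EqOn p' p W ∧ EqOn Q' Q W) ∧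
      (∃ S : PhaseSpace n → ℝ, IsPotential W p Q S) ∧
      (∀ S S' : PhaseSpace n → ℝ, IsPotential W p Q S → IsPotential W p Q S' →
        ∃ c : ℝ, ∀ w ∈ W, S' w = S w + c) ∧
      (∀ S : PhaseSpace n → ℝ, IsPotential W p Q S → ∀ x ∈ U,
        HasGradientAt (typeII T S) (canonJT (T⁻¹ • (Φ T x - x)))
          (blockI₁ x + blockI₂ (Φ T x))) := by
  obtain ⟨hbij, -, g, ⟨hgl, hgr⟩, hg⟩ := hΨ
  obtain ⟨hF, hsymp⟩ := contDiffOn_and_symplectic_flow (J := canonJL) inner_canonJL_canonJL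
    canonJL_canonJL hT.le hΩ hH hU hΦ.initial hΦ.mem hΦ.ode
  have hgU : MapsTo g W U := hgl.mapsTo hbij.surjOn
  have hfst : ∀ w ∈ W, (g w).fst = w.fst := fun w hw =>
    show (mixedMap (Φ T) (g w)).fst = w.fst by rw [hgr hw]
  have hsnd : ∀ w ∈ W, (Φ T (g w)).snd = w.snd := fun w hw =>
    show (mixedMap (Φ T) (g w)).snd = w.snd by rw [hgr hw]
  have hp : ContDiffOn ℝ 1 (fun w => (g w).snd) W := momL.contDiff.comp_contDiffOn hg
  have hQ : ContDiffOn ℝ 1 (fun w => (Φ T (g w)).fst) W :=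
    posL.contDiff.comp_contDiffOn (hF.comp hg hgU)
  have hpt : ∀ w ∈ W, pt w.fst (g w).snd = g w := fun w hw => by rw [← hfst w hw, pt_fst_snd]
  refine ⟨fun w => (g w).snd, fun w => (Φ T (g w)).fst, hp, hQ, fun w hw => ?_,
    fun p' Q' h' => ?_, ?_, fun S S' hS hS' => ?_, fun S hS x hx => ?_⟩
  · rw [hpt w hw]
    refine ⟨hgU hw, hgr hw, ?_⟩
    rw [← hsnd w hw, pt_fst_snd]
  · have hp' : EqOn p' (fun w => (g w).snd) W := fun w hw => by
      have : pt w.fst (p' w) = g w :=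
        hbij.injOn (h' w hw).1 (hgU hw) ((h' w hw).2.1.trans (hgr hw).symm)
      exact congrArg WithLp.snd this
    refine ⟨hp', fun w hw => ?_⟩
    have := (h' w hw).2.2
    rw [hp' hw, hpt w hw] at this
    exact (congrArg WithLp.fst this).symm
  · refine exists_isPotential hW hWsc hp hQ fun w hw =>
      symmetric_mixed_of_symplectic (π₁ := posL) (π₂ := momL) hU hW hF hg hgU (fun x hx a b => ?_)
        hfst hsnd hw
    have := hsymp x hx a b
    rwa [inner_canonJL_left, inner_canonJL_left] at this
  · exact hWsc.isPathConnected.isConnected.isPreconnected.exists_eq_add_const_of_hasGradientAt hW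
      (fun w hw => hS.hasGradientAt hW hw) (fun w hw => hS'.hasGradientAt hW hw)
  -- At `w = Ψ(x)` one has `g w = x`, so the gradient is `(p - P, Q - q) / T`; this equals `Jᵀ`
  -- applied to `(Q - q, P - p) / T`.
  · have hw : mixedMap (Φ T) x ∈ W := hbij.mapsTo hx
    have hpoint : blockI₁ x + blockI₂ (Φ T x) = mixedMap (Φ T) x := by
      rw [blockI₁, blockI₂, mixedMap, ← ptL_apply, ← ptL_apply, ← ptL_apply, ← map_add]
      simp
    have h1 := (hS.hasGradientAt hW hw).typeII T
    simp only [hgl hx] at h1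
    rw [hpoint]
    convert h1 using 1
    rw [canonJT, ← ptL_apply, ← ptL_apply, ← map_smul]
    simp [mixedMap, ← smul_neg]
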